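/- All spaces are real. For a Banach space $E$, $S_E$ is its unit sphere and $E^*$ its dual. Call $E$ uniformly smooth if for every $\varepsilon>0$ there is $\delta>0$ such that $\|x+y\|+\|x-y\|\le 2+\varepsilon\|y\|$ whenever $\|x\|=1$ and $\|y\|\le\delta$. A subset $A$ of a metric space $M$ is porous if there are $\lambda_0\in(0,1]$ and $r_0>0$ such that for all $x\in M$ and $r\in(0,r_0]$ there is $y\in M$ with $B(y;\lambda_0 r)\subseteq B(x;r)\cap(M\setminus A)$ (open balls); it is $\sigma$-porous if it is a countable union of porous sets. Let $X$ be a uniformly convex Banach space, $Y$ a uniformly smooth Banach space, $W\neq\{0\}$ a Banach space, and let $\theta:S_X\times S_{Y^*}\to\mathbb R$ be uniformly continuous with $\theta(-x,y^*)=\theta(x,-y^*)=-\theta(x,y^*)$ for all $(x,y^*)$, and such that $$\Pi_\theta=\Pi_\theta(X,Y):=\{(x,y^*)\in S_X\times S_{Y^*}:\theta(x,y^*)=1\}\neq\emptyset .$$ Let $C_{b,e}(\Pi_\theta,W)$ be the space of bounded continuous $\Phi:\Pi_\theta\to W$ with $\Phi(-x,-y^*)=\Phi(x,y^*)$, with the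 sup norm $\|\cdot\|_\infty$, and put $v_\theta(\Phi):=\sup_{(x,y^*)\in\Pi_\theta}\|\Phi(x,y^*)\|$. Say that $\Phi$ attains strongly (up to sign) its $\theta$-numerical radius if there is $(x_0,y_0^*)\in\Pi_\theta$ with $\|\Phi(x_0,y_0^*)\|=v_\theta(\Phi)$ and such that $$\min\big(\|x_n-x_0\|+\|y_n^*-y_0^*\|,\ \|x_n+x_0\|+\|y_n^*+y_0^*\|\big)\to0$$ for every sequence $(x_n,y_n^*)$ in $\Pi_\theta$ with $\|\Phi(x_n,y_n^*)\|\to v_\theta(\Phi)$. Let $(\mathcal Z,\|\cdot\|_{\mathcal Z})$ be a Banach space with a linear map $J:\mathcal Z\to C_{b,e}(\Pi_\theta,W)$ (for instance a linear subspace with its own complete norm and the inclusion map; $J$ need not be injective) such that (i) $\|J\Phi\|_\infty\le\|\Phi\|_{\mathcal Z}$ for all $\Phi\in\mathcal Z$; (ii) for every bounded finite rank operator $T:X\to Y$ and every $w\in W$ there is $\Phi\in\mathcal Z$ with $(J\Phi)(x,y^*)=y^*(Tx)\,w$ for all $(x,y^*)\in\Pi_\theta$ and $\|\Phi\|_{\mathcal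 Z}\le\|T\|\,\|w\|$. Then: (1) For every $\Theta\in C_{b,e}(\Pi_\theta,W)$, the set of all $\Phi\in\mathcal Z$ such that $\Theta+J\Phi$ attains strongly its $\theta$-numerical radius is the complement of a $\sigma$-porous subset of $(\mathcal Z,\|\cdot\|_{\mathcal Z})$. (2) For every $\varepsilon>0$ there is $\eta>0$ such that whenever $\Phi\in\mathcal Z$ and $(x,y^*)\in\Pi_\theta$ satisfy $v_\theta(J\Phi)=1$ and $\|(J\Phi)(x,y^*)\|>1-\eta$, there are $\Psi\in\mathcal Z$ and $(z,t^*)\in\Pi_\theta$ with $v_\theta(J\Psi)=1=\|(J\Psi)(z,t^*)\|$, $\|z-x\|+\|t^*-y^*\|<\varepsilon$ and $v_\theta(J\Psi-J\Phi)<\varepsilon$. (3) If $X$ is moreover uniformly smooth, then the set of bounded linear operators $T:X\to X$ that attain their numerical radius, i.e. for which there are $x_0\in S_X$, $x_0^*\in S_{X^*}$ with $x_0^*(x_0)=1$ and $|x_0^*(Tx_0)|=\sup\{|x^*(Tx)|:x\in S_X,\ x^*\in S_{X^*},\ x^*(x)=1\}$, is the complement of a $\sigma$-porous subset of the space of all bounded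 linear operators on $X$ with the operator norm. -/

import Mathlib

open Filter Topology
open scoped BoundedContinuousFunction

/-- A real normed space is uniformly smooth if for every `ε > 0` there is `δ > 0` such that
`‖x + y‖ + ‖x - y‖ ≤ 2 + ε ‖y‖` for all `x` with `‖x‖ = 1` and all `y` with `‖y‖ ≤ δ`; that is,
its modulus of smoothness `ρ` satisfies `ρ t / t → 0` as `t → 0`. -/
def IsUniformlySmooth (E : Type*) [NormedAddCommGroup E] [NormedSpace ℝ E] : Prop :=
  ∀ ε : ℝ, 0 < ε → ∃ δ : ℝ, 0 < δ ∧
    ∀ x y : E, ‖x‖ = 1 → ‖y‖ ≤ δ → ‖x + y‖ + ‖x - y‖ ≤ 2 + ε * ‖y‖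

/-- A subset `A` of a metric space is porous if there are `c ∈ (0, 1]` and `r₀ > 0` such that for
every point `x` and every `r ∈ (0, r₀]` some ball of radius `c * r` is contained in the ball of
centre `x` and radius `r` and misses `A`. -/
def IsPorousSet {M : Type*} [MetricSpace M] (A : Set M) : Prop :=
  ∃ c : ℝ, 0 < c ∧ c ≤ 1 ∧ ∃ r₀ : ℝ, 0 < r₀ ∧
    ∀ x : M, ∀ r : ℝ, 0 < r → r ≤ r₀ →
      ∃ y : M, Metric.ball y (c * r) ⊆ Metric.ball x r ∩ Aᶜ

/-- A set is σ-porous if it is a countable union of porous sets. -/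
def IsSigmaPorousSet {M : Type*} [MetricSpace M] (A : Set M) : Prop :=
  ∃ P : ℕ → Set M, (∀ n, IsPorousSet (P n)) ∧ A = ⋃ n, P n

/-- The product `S_X × S_{Y*}` of the unit spheres of `X` and of the dual of `Y`. -/
abbrev SphereProd (X Y : Type*) [NormedAddCommGroup X] [NormedSpace ℝ X]
    [NormedAddCommGroup Y] [NormedSpace ℝ Y] : Type _ :=
  Metric.sphere (0 : X) 1 × Metric.sphere (0 : StrongDual ℝ Y) 1

section ThetaRadius

variable {X Y : Type*} [NormedAddCommGroup X] [NormedSpace ℝ X]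
  [NormedAddCommGroup Y] [NormedSpace ℝ Y]

/-- The set `Π_θ(X, Y)` of all `(x, y*) ∈ S_X × S_{Y*}` with `θ (x, y*) = 1`. -/
def thetaPi (θ : SphereProd X Y → ℝ) : Set (SphereProd X Y) := {p | θ p = 1}

/-- The component in `X` of a point of `Π_θ(X, Y)`. -/
def thetaPiVec {θ : SphereProd X Y → ℝ} (p : thetaPi θ) : X := p.1.1

/-- The component in the dual of `Y` of a point of `Π_θ(X, Y)`. -/
def thetaPiFnl {θ : SphereProd X Y → ℝ} (p : thetaPi θ) : StrongDual ℝ Y := p.1.2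

/-- The space `C_{b,e}(Π_θ(X, Y), W)` of bounded continuous functions `Φ : Π_θ(X, Y) → W` with
`Φ (-x, -y*) = Φ (x, y*)`, a subspace of the bounded continuous functions with the sup norm. -/
def evenBCF (θ : SphereProd X Y → ℝ) (W : Type*) [NormedAddCommGroup W] [NormedSpace ℝ W] :
    Submodule ℝ (thetaPi θ →ᵇ W) where
  carrier := {Φ | ∀ p q : thetaPi θ,
    thetaPiVec q = -thetaPiVec p → thetaPiFnl q = -thetaPiFnl p → Φ q = Φ p}
  zero_mem' := fun _ _ _ _ => rfl
  add_mem' := by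
    intro Φ Ψ hΦ hΨ p q h₁ h₂
    simp [hΦ p q h₁ h₂, hΨ p q h₁ h₂]
  smul_mem' := by
    intro c Φ hΦ p q h₁ h₂
    simp [hΦ p q h₁ h₂]

variable {W : Type*} [NormedAddCommGroup W] [NormedSpace ℝ W]

/-- The `θ`-numerical radius `v_θ(Φ)`, the supremum of `‖Φ (x, y*)‖` over `Π_θ(X, Y)`. -/
noncomputable def thetaRadius {θ : SphereProd X Y → ℝ} (Φ : evenBCF θ W) : ℝ :=
  ⨆ p : thetaPi θ, ‖Φ.1 p‖

/-- `Φ` strongly (up to sign) attains its `θ`-numerical radius. -/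
def StronglyAttainsThetaRadius {θ : SphereProd X Y → ℝ} (Φ : evenBCF θ W) : Prop :=
  ∃ p₀ : thetaPi θ, ‖Φ.1 p₀‖ = thetaRadius Φ ∧
    ∀ p : ℕ → thetaPi θ,
      Tendsto (fun n => ‖Φ.1 (p n)‖) atTop (𝓝 (thetaRadius Φ)) →
      Tendsto (fun n =>
        min (‖thetaPiVec (p n) - thetaPiVec p₀‖ + ‖thetaPiFnl (p n) - thetaPiFnl p₀‖)
          (‖thetaPiVec (p n) + thetaPiVec p₀‖ + ‖thetaPiFnl (p n) + thetaPiFnl p₀‖)) atTop (𝓝 0)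

end ThetaRadius

/-- The numerical radius of a bounded operator `T` on `X`: the supremum of `|x* (T x)|` over all
`x ∈ S_X` and `x* ∈ S_{X*}` with `x* x = 1`. -/
noncomputable def numericalRadius {X : Type*} [NormedAddCommGroup X] [NormedSpace ℝ X]
    (T : X →L[ℝ] X) : ℝ :=
  sSup {s : ℝ | ∃ (x : X) (f : StrongDual ℝ X), ‖x‖ = 1 ∧ ‖f‖ = 1 ∧ f x = 1 ∧ s = |f (T x)|}

/-- `T` attains its numerical radius. -/
def AttainsNumericalRadius {X : Type*} [NormedAddCommGroup X] [NormedSpace ℝ X]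
    (T : X →L[ℝ] X) : Prop :=
  ∃ (x : X) (f : StrongDual ℝ X), ‖x‖ = 1 ∧ ‖f‖ = 1 ∧ f x = 1 ∧ |f (T x)| = numericalRadius T

/-! If the near-maximal points of `F = Θ + J Φ` lie, up to sign, in arbitrarily small balls,
completeness of `Π_θ` gives strong attainment. So for (1) it suffices that, for each `ε`, failure of
`LocalizesThetaRadius` at scale `ε` is porous.

Porosity comes from `exists_rankOne_peak`. Take `T = g ⊗ y` with `g` norming `x₀` and `y` almost
norming `y₀*`. If `|y* (T x)| = |g x| |y* y|` is near 1, uniform convexity puts `±x` near `x₀` and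
uniform smoothness puts `±y*` near `y₀*`. Opposite signs are impossible, since `θ` would be `-1`
near a point where it is 1. The gap `δ` depends on `ε` only. Placing this peak at a nearly maximal
point of `F`, in the direction of the value there, gives a gap proportional to the size of the
perturbation, so it survives on a whole ball.

For (2), the peak is placed at the given point; by Baire an attaining element lies nearby, the gap
locates its maximum, and it is normalised. (3) is (1) for the duality pairing. -/

/-! ### Porous and σ-porous sets -/

theorem IsPorousSet.mono {M : Type*} [MetricSpace M] {A B : Set M} (hB : IsPorousSet B)
    (h : A ⊆ B) : IsPorousSet A := by
  obtain ⟨c, hc, hc1, r₀, hr₀, H⟩ := hB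
  refine ⟨c, hc, hc1, r₀, hr₀, fun x r hr hr' => ?_⟩
  obtain ⟨y, hy⟩ := H x r hr hr'
  exact ⟨y, hy.trans (Set.inter_subset_inter_right _ (Set.compl_subset_compl.2 h))⟩

theorem isSigmaPorousSet_of_subset_iUnion {M : Type*} [MetricSpace M] {A : Set M} {P : ℕ → Set M}
    (hP : ∀ n, IsPorousSet (P n)) (h : A ⊆ ⋃ n, P n) : IsSigmaPorousSet A := by
  refine ⟨fun n => A ∩ P n, fun n => (hP n).mono Set.inter_subset_right, ?_⟩
  rw [← Set.inter_iUnion, Set.inter_eq_left.2 h]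

theorem IsSigmaPorousSet.mono {M : Type*} [MetricSpace M] {A B : Set M} (hB : IsSigmaPorousSet B)
    (h : A ⊆ B) : IsSigmaPorousSet A := by
  obtain ⟨P, hP, rfl⟩ := hB
  exact isSigmaPorousSet_of_subset_iUnion hP h

theorem IsPorousSet.dense_interior_compl {M : Type*} [MetricSpace M] {A : Set M}
    (hA : IsPorousSet A) : Dense (interior Aᶜ) := by
  obtain ⟨c, hc, _, r₀, hr₀, H⟩ := hA
  refine Metric.dense_iff.2 fun x r hr => ?_
  obtain ⟨y, hy⟩ := H x (min r r₀) (lt_min hr hr₀) (min_le_right _ _)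
  have hpos : 0 < c * min r r₀ := mul_pos hc (lt_min hr hr₀)
  refine ⟨y, Metric.ball_subset_ball (min_le_left _ _) (hy (Metric.mem_ball_self hpos)).1, ?_⟩
  exact mem_interior.2 ⟨_, fun z hz => (hy hz).2, Metric.isOpen_ball, Metric.mem_ball_self hpos⟩

/-- Porous sets are nowhere dense, so Baire's theorem applies. -/
theorem IsSigmaPorousSet.dense_compl {M : Type*} [MetricSpace M] [CompleteSpace M] {A : Set M}
    (hA : IsSigmaPorousSet A) : Dense Aᶜ := by
  obtain ⟨P, hP, rfl⟩ := hA
  refine (dense_iInter_of_isOpen (f := fun n => interior (P n)ᶜ) (fun n => isOpen_interior)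
    fun n => (hP n).dense_interior_compl).mono ?_
  rw [Set.compl_iUnion]
  exact Set.iInter_mono fun n => interior_subset

/-! ### Geometry of norms -/

/-- In the dual of a uniformly smooth space, norm one functionals that are almost normed by the
same unit vector are close to each other, uniformly. -/
theorem IsUniformlySmooth.exists_norm_sub_lt {E : Type*} [NormedAddCommGroup E] [NormedSpace ℝ E]
    (hE : IsUniformlySmooth E) {ε : ℝ} (hε : 0 < ε) :
    ∃ δ : ℝ, 0 < δ ∧ ∀ (y : E) (f g : StrongDual ℝ E), ‖y‖ = 1 → ‖f‖ = 1 → ‖g‖ = 1 →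
      1 - δ < f y → 1 - δ < g y → ‖f - g‖ < ε := by
  obtain ⟨t, ht, H⟩ := hE (ε / 4) (by positivity)
  -- Adding the bounds on `f (y + t z)` and `g (y - t z)` gives `t (f - g) z ≤ ε t / 4 + 2 δ`; this
  -- `δ` makes the right side `ε t / 2`.
  refine ⟨ε / 8 * t, by positivity, fun y f g hy hf hg hfy hgy => ?_⟩
  have key : ∀ z : E, ‖z‖ = 1 → (f - g) z ≤ ε / 2 := by
    intro z hz
    have hn : ‖t • z‖ = t := by rw [norm_smul, hz, mul_one, Real.norm_of_nonneg ht.le]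
    have h := H y (t • z) hy hn.le
    rw [hn] at h
    have h1 : f (y + t • z) ≤ ‖y + t • z‖ := by
      simpa [hf] using (le_abs_self _).trans (f.le_opNorm (y + t • z))
    have h2 : g (y - t • z) ≤ ‖y - t • z‖ := by
      simpa [hg] using (le_abs_self _).trans (g.le_opNorm (y - t • z))
    simp only [map_add, map_sub, map_smul, smul_eq_mul] at h1 h2
    have h3 : t * (f - g) z ≤ t * (ε / 2) := by
      rw [sub_apply]
      nlinarith
    exact le_of_mul_le_mul_left h3 ht
  refine lt_of_le_of_lt (ContinuousLinearMap.opNorm_le_of_unit_norm (by positivity)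
    fun z hz => ?_) (half_lt_self hε)
  refine abs_le.2 ⟨?_, key z hz⟩
  have := key (-z) (by rwa [norm_neg])
  rw [map_neg] at this
  linarith

/-- In a uniformly convex space, the slices of the sphere cut by norm one functionals that attain
their norm have uniformly small diameter. -/
theorem UniformConvexSpace.exists_norm_sub_lt (E : Type*) [NormedAddCommGroup E] [NormedSpace ℝ E]
    [UniformConvexSpace E] {ε : ℝ} (hε : 0 < ε) :
    ∃ δ : ℝ, 0 < δ ∧ ∀ (x y : E) (f : StrongDual ℝ E), ‖x‖ = 1 → ‖y‖ = 1 → ‖f‖ = 1 →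
      f y = 1 → 1 - δ < f x → ‖x - y‖ < ε := by
  obtain ⟨δ, hδ, H⟩ := exists_forall_sphere_dist_add_le_two_sub E hε
  refine ⟨δ, hδ, fun x y f hx hy hf hfy hfx => ?_⟩
  by_contra! hcon
  have h := H hx hy hcon
  have h1 : f (x + y) ≤ ‖x + y‖ := by
    simpa [hf] using (le_abs_self _).trans (f.le_opNorm (x + y))
  rw [map_add] at h1
  linarith

/-- The four sign patterns behind the triangle inequality for `thetaPiSignDist`. -/
theorem norm_sub_le_and_norm_add_le {E : Type*} [NormedAddCommGroup E] (a b c : E) :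
    ‖a - b‖ ≤ ‖a - c‖ + ‖b - c‖ ∧ ‖a - b‖ ≤ ‖a + c‖ + ‖b + c‖ ∧
      ‖a + b‖ ≤ ‖a - c‖ + ‖b + c‖ ∧ ‖a + b‖ ≤ ‖a + c‖ + ‖b - c‖ := by
  refine ⟨?_, ?_, ?_, ?_⟩
  · simpa using norm_sub_le (a - c) (b - c)
  · simpa using norm_sub_le (a + c) (b + c)
  · simpa using norm_add_le (a - c) (b + c)
  · simpa using norm_add_le (a + c) (b - c)

/-- Vectors close to a common unit vector cannot be nearly antipodal. -/
theorem two_le_norm_add_of_norm_eq_one {E : Type*} [NormedAddCommGroup E] [NormedSpace ℝ E]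
    {a b c : E} (hc : ‖c‖ = 1) : 2 ≤ ‖a + b‖ + (‖a - c‖ + ‖b - c‖) := by
  have h1 : ‖c + c‖ = 2 := by rw [← two_smul ℝ c, norm_smul, hc]; norm_num
  have h2 := norm_sub_le (a + b) (a - c + (b - c))
  have h3 := norm_add_le (a - c) (b - c)
  rw [show a + b - (a - c + (b - c)) = c + c by abel, h1] at h2
  linarith

/-! ### Distance up to sign and peaking rank one operators -/

section ThetaRadius

variable {X Y : Type*} [NormedAddCommGroup X] [NormedSpace ℝ X]
  [NormedAddCommGroup Y] [NormedSpace ℝ Y] {θ : SphereProd X Y → ℝ}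

theorem norm_thetaPiVec (p : thetaPi θ) : ‖thetaPiVec p‖ = 1 := by
  simp [thetaPiVec]

theorem norm_thetaPiFnl (p : thetaPi θ) : ‖thetaPiFnl p‖ = 1 := by
  simp [thetaPiFnl]

theorem thetaPi_dist_le (p q : thetaPi θ) :
    dist p q ≤ ‖thetaPiVec p - thetaPiVec q‖ + ‖thetaPiFnl p - thetaPiFnl q‖ := by
  rw [Subtype.dist_eq, Prod.dist_eq, Subtype.dist_eq, Subtype.dist_eq, dist_eq_norm, dist_eq_norm]
  exact max_le_add_of_nonneg (norm_nonneg _) (norm_nonneg _)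

/-- The distance of two points of `Π_θ` up to sign. -/
noncomputable def thetaPiSignDist (p q : thetaPi θ) : ℝ :=
  min (‖thetaPiVec p - thetaPiVec q‖ + ‖thetaPiFnl p - thetaPiFnl q‖)
    (‖thetaPiVec p + thetaPiVec q‖ + ‖thetaPiFnl p + thetaPiFnl q‖)

theorem thetaPiSignDist_nonneg (p q : thetaPi θ) : 0 ≤ thetaPiSignDist p q :=
  le_min (by positivity) (by positivity)

theorem thetaPiSignDist_triangle_right (p q r : thetaPi θ) :
    thetaPiSignDist p q ≤ thetaPiSignDist p r + thetaPiSignDist q r := by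
  obtain ⟨h1, h2, h3, h4⟩ :=
    norm_sub_le_and_norm_add_le (thetaPiVec p) (thetaPiVec q) (thetaPiVec r)
  obtain ⟨k1, k2, k3, k4⟩ :=
    norm_sub_le_and_norm_add_le (thetaPiFnl p) (thetaPiFnl q) (thetaPiFnl r)
  unfold thetaPiSignDist
  grind

theorem exists_neg_thetaPi (h₁ : ∀ x f, θ (-x, f) = -θ (x, f)) (h₂ : ∀ x f, θ (x, -f) = -θ (x, f))
    (p : thetaPi θ) : ∃ q : thetaPi θ, thetaPiVec q = -thetaPiVec p ∧
      thetaPiFnl q = -thetaPiFnl p := by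
  obtain ⟨⟨x, f⟩, hp⟩ := p
  refine ⟨⟨(-x, -f), ?_⟩, rfl, rfl⟩
  change θ (-x, -f) = 1
  rw [h₁, h₂, neg_neg]
  exact hp

/-- A rank one operator of norm at most one for which `y* (T x)` peaks at a given point of `Π_θ`
and its antipode, with a uniform gap. -/
theorem exists_rankOne_peak [UniformConvexSpace X] (hY : IsUniformlySmooth Y)
    (hθ : UniformContinuous θ) (h₁ : ∀ x f, θ (-x, f) = -θ (x, f))
    (h₂ : ∀ x f, θ (x, -f) = -θ (x, f)) {ε : ℝ} (hε : 0 < ε) :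
    ∃ δ : ℝ, 0 < δ ∧ δ ≤ 1 ∧ ∀ p₀ : thetaPi θ, ∃ T : X →L[ℝ] Y,
      FiniteDimensional ℝ (LinearMap.range T.toLinearMap) ∧ ‖T‖ ≤ 1 ∧
      1 - δ / 4 ≤ thetaPiFnl p₀ (T (thetaPiVec p₀)) ∧
      ∀ p : thetaPi θ, ε ≤ thetaPiSignDist p p₀ → |thetaPiFnl p (T (thetaPiVec p))| ≤ 1 - δ := by
  -- Within `ρ` of a point of `Π_θ`, `θ` is positive, so it cannot be `-1`.
  obtain ⟨ρ, hρ, hρ'⟩ := Metric.uniformContinuous_iff.1 hθ 1 one_pos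
  have hε' : 0 < min (ε / 2) ρ := lt_min (half_pos hε) hρ
  obtain ⟨δ₁, hδ₁, H₁⟩ := UniformConvexSpace.exists_norm_sub_lt X hε'
  obtain ⟨δ₂, hδ₂, H₂⟩ := hY.exists_norm_sub_lt hε'
  obtain ⟨δ, hδ, hδ1, hδδ₁, hδδ₂⟩ : ∃ δ : ℝ, 0 < δ ∧ δ ≤ 1 ∧ δ ≤ δ₁ ∧ δ ≤ δ₂ :=
    ⟨min 1 (min δ₁ δ₂), by positivity, by simp, by simp, by simp⟩
  refine ⟨δ, hδ, hδ1, ?_⟩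
  rintro ⟨⟨x₀, f₀⟩, hp₀⟩
  have hx₀ : ‖(x₀ : X)‖ = 1 := by simp
  have hf₀ : ‖(f₀ : StrongDual ℝ Y)‖ = 1 := by simp
  obtain ⟨g, hg, hgx⟩ := exists_dual_vector ℝ (x₀ : X) (by rw [hx₀]; exact one_ne_zero)
  obtain ⟨y, hy, hfy⟩ : ∃ y : Y, ‖y‖ = 1 ∧ 1 - δ / 4 < (f₀ : StrongDual ℝ Y) y := by
    by_contra! hcon
    have : ‖(f₀ : StrongDual ℝ Y)‖ ≤ 1 - δ / 4 := by
      refine ContinuousLinearMap.opNorm_le_of_unit_norm (by linarith) fun z hz => ?_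
      refine abs_le'.2 ⟨hcon z hz, ?_⟩
      rw [← map_neg]
      exact hcon (-z) (by rwa [norm_neg])
    linarith
  have hgx' : g x₀ = 1 := by rw [hgx, hx₀]; rfl
  refine ⟨g.smulRight y, ?_, ?_, ?_, ?_⟩
  · refine Submodule.finiteDimensional_of_le (S₂ := Submodule.span ℝ {y}) ?_
    rintro _ ⟨x, rfl⟩
    exact Submodule.mem_span_singleton.2 ⟨g x, rfl⟩
  · rw [ContinuousLinearMap.norm_smulRight_apply, hg, hy, one_mul]
  · change 1 - δ / 4 ≤ (f₀ : StrongDual ℝ Y) (g x₀ • y)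
    rw [hgx', one_smul]
    exact hfy.le
  · rintro ⟨⟨x, f⟩, hp⟩ hfar
    have hx : ‖(x : X)‖ = 1 := by simp
    have hf : ‖(f : StrongDual ℝ Y)‖ = 1 := by simp
    change |(f : StrongDual ℝ Y) (g x • y)| ≤ 1 - δ
    by_contra! hcon
    rw [map_smul, smul_eq_mul, abs_mul] at hcon
    have hgx1 : |g x| ≤ 1 := by simpa [hg, hx] using g.le_opNorm x
    have hfy1 : |(f : StrongDual ℝ Y) y| ≤ 1 := by simpa [hf, hy] using f.1.le_opNorm y
    have hA : 1 - δ < |g x| :=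
      hcon.trans_le (mul_le_of_le_one_right (abs_nonneg _) hfy1)
    have hB : 1 - δ < |(f : StrongDual ℝ Y) y| :=
      hcon.trans_le (mul_le_of_le_one_left (abs_nonneg _) hgx1)
    have hX : ∀ u : Metric.sphere (0 : X) 1, 1 - δ < g u → ‖(u : X) - x₀‖ < min (ε / 2) ρ :=
      fun u hu => H₁ u x₀ g (by simp) hx₀ hg hgx' (by linarith)
    have hF : ∀ u : Metric.sphere (0 : StrongDual ℝ Y) 1, 1 - δ < (u : StrongDual ℝ Y) y →
        ‖(u : StrongDual ℝ Y) - f₀‖ < min (ε / 2) ρ :=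
      fun u hu => H₂ y u f₀ hy (by simp) hf₀ (by linarith) (by linarith)
    have hθ' : ∀ (u : Metric.sphere (0 : X) 1) (v : Metric.sphere (0 : StrongDual ℝ Y) 1),
        ‖(u : X) - x₀‖ < min (ε / 2) ρ → ‖(v : StrongDual ℝ Y) - f₀‖ < min (ε / 2) ρ →
        θ (u, v) ≠ -1 := by
      intro u v hu hv huv
      have := @hρ' (u, v) (x₀, f₀) (by
        rw [Prod.dist_eq, Subtype.dist_eq, Subtype.dist_eq, dist_eq_norm, dist_eq_norm]
        exact max_lt (hu.trans_le (min_le_right _ _)) (hv.trans_le (min_le_right _ _)))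
      rw [huv, show θ (x₀, f₀) = 1 from hp₀, Real.dist_eq] at this
      norm_num at this
    have hp' : θ (x, f) = 1 := hp
    have hm := min_le_left (ε / 2) ρ
    change ε ≤ min (‖(x : X) - x₀‖ + ‖(f : StrongDual ℝ Y) - f₀‖)
      (‖(x : X) + x₀‖ + ‖(f : StrongDual ℝ Y) + f₀‖) at hfar
    obtain ⟨hfar₁, hfar₂⟩ := le_min_iff.1 hfar
    have eX : ‖((-x : Metric.sphere (0 : X) 1) : X) - x₀‖ = ‖(x : X) + x₀‖ := by
      rw [← norm_neg]; congr 1; simp [add_comm]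
    have eF : ‖((-f : Metric.sphere (0 : StrongDual ℝ Y) 1) : StrongDual ℝ Y) - f₀‖ =
        ‖(f : StrongDual ℝ Y) + f₀‖ := by
      rw [← norm_neg]; congr 1; simp [add_comm]
    -- Equal signs put `(x, f)` or its antipode within `ε` of `(x₀, f₀)`; opposite signs would give
    -- `θ = -1` within `ρ` of it.
    rcases abs_choice (g x) with hgs | hgs <;>
      rcases abs_choice ((f : StrongDual ℝ Y) y) with hfs | hfs <;>
      rw [hgs] at hA <;> rw [hfs] at hB
    · linarith [hX x hA, hF f hB]
    · exact hθ' x (-f) (hX x hA) (hF (-f) (by simpa using hB)) (by rw [h₂, hp'])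
    · exact hθ' (-x) f (hX (-x) (by simpa using hA)) (hF f hB) (by rw [h₁, hp'])
    · have h3 := hX (-x) (by simpa using hA)
      have h4 := hF (-f) (by simpa using hB)
      rw [eX] at h3
      rw [eF] at h4
      linarith

/-! ### Localization implies strong attainment -/

variable {W : Type*} [NormedAddCommGroup W] [NormedSpace ℝ W]

theorem thetaRadius_eq_norm (Φ : evenBCF θ W) : thetaRadius Φ = ‖Φ‖ :=
  (BoundedContinuousFunction.norm_eq_iSup_norm Φ.1).symm

theorem evenBCF_norm_apply_le (Φ : evenBCF θ W) (p : thetaPi θ) : ‖Φ.1 p‖ ≤ ‖Φ‖ :=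
  Φ.1.norm_coe_le_norm p

theorem exists_lt_norm_apply (hne : (thetaPi θ).Nonempty) (Φ : evenBCF θ W) {a : ℝ}
    (ha : a < ‖Φ‖) : ∃ p : thetaPi θ, a < ‖Φ.1 p‖ := by
  have := hne.to_subtype
  rw [← thetaRadius_eq_norm] at ha
  exact exists_lt_of_lt_ciSup ha

/-- Near-maximal points of `Φ` lie, up to sign, in a ball of radius `ε` about a fixed point. -/
def LocalizesThetaRadius (Φ : evenBCF θ W) (ε : ℝ) : Prop :=
  ∃ p₀ : thetaPi θ, ∃ γ : ℝ, 0 < γ ∧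
    ∀ p : thetaPi θ, ‖Φ‖ - γ < ‖Φ.1 p‖ → thetaPiSignDist p p₀ < ε

theorem completeSpace_thetaPi [CompleteSpace X] (hθ : Continuous θ) :
    CompleteSpace (thetaPi θ) := by
  have : CompleteSpace (Metric.sphere (0 : X) 1) := Metric.isClosed_sphere.completeSpace_coe
  have : CompleteSpace (Metric.sphere (0 : StrongDual ℝ Y) 1) :=
    Metric.isClosed_sphere.completeSpace_coe
  have : IsClosed (thetaPi θ) := isClosed_eq hθ continuous_const
  exact this.completeSpace_coe

theorem stronglyAttainsThetaRadius_of_localizes [CompleteSpace X] (hθ : Continuous θ)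
    (h₁ : ∀ x f, θ (-x, f) = -θ (x, f)) (h₂ : ∀ x f, θ (x, -f) = -θ (x, f))
    (hne : (thetaPi θ).Nonempty) (Φ : evenBCF θ W)
    (hΦ : ∀ n : ℕ, LocalizesThetaRadius Φ (1 / (n + 1))) : StronglyAttainsThetaRadius Φ := by
  have := completeSpace_thetaPi hθ
  have hloc : ∀ ε : ℝ, 0 < ε → ∃ γ : ℝ, 0 < γ ∧ ∀ p q : thetaPi θ,
      ‖Φ‖ - γ < ‖Φ.1 p‖ → ‖Φ‖ - γ < ‖Φ.1 q‖ → thetaPiSignDist p q < ε := by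
    intro ε hε
    obtain ⟨n, hn⟩ := exists_nat_one_div_lt (half_pos hε)
    obtain ⟨p₀, γ, hγ, H⟩ := hΦ n
    refine ⟨γ, hγ, fun p q hp hq => ?_⟩
    linarith [thetaPiSignDist_triangle_right p q p₀, H p hp, H q hq]
  -- The near-maximal point `b` fixes signs: by evenness, each term of a maximizing sequence may be
  -- replaced by its antipode to lie within 1 of `b`.
  obtain ⟨γ, hγ, Hγ⟩ := hloc 1 one_pos
  obtain ⟨b, hb⟩ := exists_lt_norm_apply hne Φ (sub_lt_self _ hγ)
  have hseq : ∀ n : ℕ, ∃ q : thetaPi θ, ‖Φ‖ - 1 / ((n : ℝ) + 1) < ‖Φ.1 q‖ ∧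
      ‖thetaPiVec q - thetaPiVec b‖ + ‖thetaPiFnl q - thetaPiFnl b‖ < 1 := by
    intro n
    obtain ⟨q, hq⟩ := exists_lt_norm_apply hne Φ
      (sub_lt_self ‖Φ‖ (lt_min hγ (Nat.one_div_pos_of_nat (n := n))))
    have hq1 : ‖Φ‖ - 1 / ((n : ℝ) + 1) < ‖Φ.1 q‖ :=
      lt_of_le_of_lt (sub_le_sub_left (min_le_right _ _) _) hq
    have hq2 := Hγ q b (lt_of_le_of_lt (sub_le_sub_left (min_le_left _ _) _) hq) hb
    rcases min_lt_iff.1 hq2 with h | h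
    · exact ⟨q, hq1, h⟩
    · obtain ⟨q', hv, hf⟩ := exists_neg_thetaPi h₁ h₂ q
      refine ⟨q', by rwa [Φ.2 q q' hv hf], ?_⟩
      rwa [hv, hf, ← neg_add', norm_neg, ← neg_add', norm_neg]
  choose q hq hqb using hseq
  have hqt : Tendsto (fun n => ‖Φ.1 (q n)‖) atTop (𝓝 ‖Φ‖) := by
    refine tendsto_of_tendsto_of_tendsto_of_le_of_le (g := fun n : ℕ => ‖Φ‖ - 1 / ((n : ℝ) + 1))
      ?_ tendsto_const_nhds (fun n => (hq n).le) fun n => evenBCF_norm_apply_le Φ _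
    simpa using (tendsto_const_nhds (x := ‖Φ‖)).sub tendsto_one_div_add_atTop_nhds_zero_nat
  have hcau : CauchySeq q := by
    refine Metric.cauchySeq_iff.2 fun ε hε => ?_
    -- The antipodal alternative would give `4 < 1/2 + 1 + 1`, by `two_le_norm_add_of_norm_eq_one`
    -- in both components.
    obtain ⟨γ', hγ', Hγ'⟩ := hloc (min ε (1 / 2)) (by positivity)
    obtain ⟨N, hN⟩ := eventually_atTop.1 (hqt.eventually_const_lt (sub_lt_self _ hγ'))
    refine ⟨N, fun m hm n hn => ?_⟩
    have h := Hγ' _ _ (hN m hm) (hN n hn)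
    rcases min_lt_iff.1 h with h' | h'
    · exact (thetaPi_dist_le _ _).trans_lt (h'.trans_le (min_le_left _ _))
    · have h3 := two_le_norm_add_of_norm_eq_one (a := thetaPiVec (q m)) (b := thetaPiVec (q n))
        (norm_thetaPiVec b)
      have h4 := two_le_norm_add_of_norm_eq_one (a := thetaPiFnl (q m)) (b := thetaPiFnl (q n))
        (norm_thetaPiFnl b)
      linarith [hqb m, hqb n, h'.trans_le (min_le_right _ _)]
  obtain ⟨p₀, hp₀⟩ := cauchySeq_tendsto_of_complete hcau
  have hmax : ‖Φ.1 p₀‖ = ‖Φ‖ :=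
    tendsto_nhds_unique (((Φ.1.continuous.norm).tendsto p₀).comp hp₀) hqt
  refine ⟨p₀, by rw [thetaRadius_eq_norm, hmax], fun p hp => ?_⟩
  rw [thetaRadius_eq_norm] at hp
  refine Metric.tendsto_atTop.2 fun ε hε => ?_
  obtain ⟨γ', hγ', Hγ'⟩ := hloc ε hε
  obtain ⟨N, hN⟩ := eventually_atTop.1 (hp.eventually_const_lt (sub_lt_self _ hγ'))
  refine ⟨N, fun n hn => ?_⟩
  change dist (thetaPiSignDist (p n) p₀) 0 < ε
  rw [Real.dist_0_eq_abs, abs_of_nonneg (thetaPiSignDist_nonneg _ _)]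
  exact Hγ' _ _ (hN n hn) (by rw [hmax]; linarith)

/-! ### Peaking perturbations, porosity and the Bishop-Phelps-Bollobás property -/

variable {Z : Type*} [NormedAddCommGroup Z] [NormedSpace ℝ Z]

/-- Adding a small element of `Z` to `F` makes it peak at a prescribed point and its antipode. -/
theorem exists_peaking_perturbation [UniformConvexSpace X] (hY : IsUniformlySmooth Y)
    [Nontrivial W] (hθ : UniformContinuous θ) (h₁ : ∀ x f, θ (-x, f) = -θ (x, f))
    (h₂ : ∀ x f, θ (x, -f) = -θ (x, f)) (J : Z →ₗ[ℝ] evenBCF θ W)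
    (hJ : ∀ T : X →L[ℝ] Y, FiniteDimensional ℝ (LinearMap.range T.toLinearMap) →
      ∀ w : W, ∃ Φ : Z, (∀ p : thetaPi θ, (J Φ).1 p = thetaPiFnl p (T (thetaPiVec p)) • w) ∧
        ‖Φ‖ ≤ ‖T‖ * ‖w‖) {ε : ℝ} (hε : 0 < ε) :
    ∃ δ : ℝ, 0 < δ ∧ δ ≤ 1 ∧ ∀ (F : evenBCF θ W) (p₀ : thetaPi θ), ∃ H : Z, ‖H‖ ≤ 1 ∧
      ∀ s : ℝ, 0 ≤ s → ‖F.1 p₀‖ + s * (1 - δ / 4) ≤ ‖(F + s • J H).1 p₀‖ ∧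
        ∀ p : thetaPi θ, ε ≤ thetaPiSignDist p p₀ →
          ‖(F + s • J H).1 p‖ ≤ ‖F‖ + s * (1 - δ) := by
  obtain ⟨δ, hδ, hδ1, hT⟩ := exists_rankOne_peak hY hθ h₁ h₂ hε
  refine ⟨δ, hδ, hδ1, fun F p₀ => ?_⟩
  obtain ⟨T, hTf, hT1, hTp, hTfar⟩ := hT p₀
  -- With `w` aligned to `F p₀`, the norms at `p₀` add without cancellation.
  obtain ⟨w, hw, hFw⟩ : ∃ w : W, ‖w‖ = 1 ∧ F.1 p₀ = ‖F.1 p₀‖ • w := by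
    by_cases h0 : F.1 p₀ = 0
    · obtain ⟨w, hw⟩ := exists_norm_eq W zero_le_one
      exact ⟨w, hw, by simp [h0]⟩
    · have h0' : ‖F.1 p₀‖ ≠ 0 := norm_ne_zero_iff.2 h0
      refine ⟨‖F.1 p₀‖⁻¹ • F.1 p₀, ?_, ?_⟩
      · rw [norm_smul, norm_inv, norm_norm, inv_mul_cancel₀ h0']
      · rw [smul_smul, mul_inv_cancel₀ h0', one_smul]
  obtain ⟨H, hH, hHn⟩ := hJ T hTf w
  have happ : ∀ (s : ℝ) (p : thetaPi θ), (F + s • J H).1 p =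
      F.1 p + (s * thetaPiFnl p (T (thetaPiVec p))) • w := by
    intro s p
    rw [mul_smul, ← hH p]
    rfl
  refine ⟨H, hHn.trans (by rwa [hw, mul_one]), fun s hs => ⟨?_, fun p hp => ?_⟩⟩
  · rw [happ, hFw, ← add_smul, norm_smul, norm_smul, hw, mul_one, mul_one, norm_norm]
    refine le_trans ?_ (le_abs_self _)
    gcongr
  · rw [happ]
    refine (norm_add_le _ _).trans (add_le_add (evenBCF_norm_apply_le F p) ?_)
    rw [norm_smul, hw, mul_one, Real.norm_eq_abs, abs_mul, abs_of_nonneg hs]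
    exact mul_le_mul_of_nonneg_left (hTfar p hp) hs

theorem norm_map_apply_sub_le (J : Z →ₗ[ℝ] evenBCF θ W) (hJ_norm : ∀ Φ : Z, ‖J Φ‖ ≤ ‖Φ‖)
    (Φ Ψ : Z) (p : thetaPi θ) : ‖(J Φ).1 p - (J Ψ).1 p‖ ≤ ‖Φ - Ψ‖ := by
  have h := (evenBCF_norm_apply_le (J (Φ - Ψ)) p).trans (hJ_norm (Φ - Ψ))
  rwa [map_sub] at h

theorem isPorousSet_not_localizes [UniformConvexSpace X] (hY : IsUniformlySmooth Y)
    [Nontrivial W] (hθ : UniformContinuous θ) (h₁ : ∀ x f, θ (-x, f) = -θ (x, f))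
    (h₂ : ∀ x f, θ (x, -f) = -θ (x, f)) (hne : (thetaPi θ).Nonempty) (J : Z →ₗ[ℝ] evenBCF θ W)
    (hJ_norm : ∀ Φ : Z, ‖J Φ‖ ≤ ‖Φ‖)
    (hJ : ∀ T : X →L[ℝ] Y, FiniteDimensional ℝ (LinearMap.range T.toLinearMap) →
      ∀ w : W, ∃ Φ : Z, (∀ p : thetaPi θ, (J Φ).1 p = thetaPiFnl p (T (thetaPiVec p)) • w) ∧
        ‖Φ‖ ≤ ‖T‖ * ‖w‖) {ε : ℝ} (hε : 0 < ε) (Θ : evenBCF θ W) :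
    IsPorousSet {Φ : Z | ¬ LocalizesThetaRadius (Θ + J Φ) ε} := by
  obtain ⟨δ, hδ, hδ1, hpeak⟩ := exists_peaking_perturbation hY hθ h₁ h₂ J hJ hε
  -- After the perturbation of size `r / 2`, the value at `p₀` beats all far values by `r δ / 4`.
  -- Errors `r δ / 16` at two points leave `r δ / 8`, which serves as `γ`.
  refine ⟨δ / 16, by positivity, by linarith, 1, one_pos, fun Φ r hr _ => ?_⟩
  obtain ⟨p₀, hp₀⟩ := exists_lt_norm_apply hne (Θ + J Φ)
    (sub_lt_self _ (show 0 < r / 2 * (δ / 4) by positivity))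
  obtain ⟨H, hH1, hH⟩ := hpeak (Θ + J Φ) p₀
  obtain ⟨hat, hfar⟩ := hH (r / 2) (by positivity)
  refine ⟨Φ + (r / 2) • H, fun Ψ hΨ => ⟨?_, ?_⟩⟩
  · rw [Metric.mem_ball, dist_eq_norm] at hΨ ⊢
    have h1 : ‖Ψ - Φ‖ ≤ ‖Ψ - (Φ + (r / 2) • H)‖ + ‖(r / 2) • H‖ := by
      refine le_trans (le_of_eq ?_) (norm_add_le _ _)
      congr 1; abel
    have h2 : ‖(r / 2) • H‖ ≤ r / 2 := by
      rw [norm_smul, Real.norm_of_nonneg (by positivity)]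
      exact mul_le_of_le_one_right (by positivity) hH1
    nlinarith
  · rw [Metric.mem_ball, dist_eq_norm] at hΨ
    have hclose : ∀ p : thetaPi θ,
        |‖(Θ + J Ψ).1 p‖ - ‖(Θ + J Φ + (r / 2) • J H).1 p‖| ≤ δ / 16 * r := by
      intro p
      refine ((abs_norm_sub_norm_le _ _).trans (le_of_eq ?_)).trans
        ((norm_map_apply_sub_le J hJ_norm Ψ (Φ + (r / 2) • H) p).trans hΨ.le)
      rw [map_add, map_smul]
      change ‖(Θ.1 p + (J Ψ).1 p) - (Θ.1 p + (J Φ).1 p + (r / 2) • (J H).1 p)‖ =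
        ‖(J Ψ).1 p - ((J Φ).1 p + (r / 2) • (J H).1 p)‖
      congr 1; abel
    refine not_not.2 ⟨p₀, r * δ / 8, by positivity, fun p hp => ?_⟩
    by_contra! hcon
    have h1 := hfar p hcon
    have h2 := abs_le.1 (hclose p)
    have h3 := abs_le.1 (hclose p₀)
    have h4 := evenBCF_norm_apply_le (Θ + J Ψ) p₀
    linarith [h2.1, h2.2, h3.1, h3.2]

theorem isSigmaPorousSet_compl_stronglyAttains [CompleteSpace X] [UniformConvexSpace X]
    (hY : IsUniformlySmooth Y) [Nontrivial W] (hθ : UniformContinuous θ)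
    (h₁ : ∀ x f, θ (-x, f) = -θ (x, f)) (h₂ : ∀ x f, θ (x, -f) = -θ (x, f))
    (hne : (thetaPi θ).Nonempty) (J : Z →ₗ[ℝ] evenBCF θ W) (hJ_norm : ∀ Φ : Z, ‖J Φ‖ ≤ ‖Φ‖)
    (hJ : ∀ T : X →L[ℝ] Y, FiniteDimensional ℝ (LinearMap.range T.toLinearMap) →
      ∀ w : W, ∃ Φ : Z, (∀ p : thetaPi θ, (J Φ).1 p = thetaPiFnl p (T (thetaPiVec p)) • w) ∧
        ‖Φ‖ ≤ ‖T‖ * ‖w‖) (Θ : evenBCF θ W) :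
    IsSigmaPorousSet {Φ : Z | StronglyAttainsThetaRadius (Θ + J Φ)}ᶜ := by
  refine isSigmaPorousSet_of_subset_iUnion (fun n : ℕ => isPorousSet_not_localizes hY hθ h₁ h₂ hne
    J hJ_norm hJ (Nat.one_div_pos_of_nat (n := n)) Θ) fun Φ hΦ => ?_
  by_contra hcon
  refine hΦ (stronglyAttainsThetaRadius_of_localizes hθ.continuous h₁ h₂ hne _ fun n => ?_)
  by_contra hn
  exact hcon (Set.mem_iUnion.2 ⟨n, hn⟩)

/-- The Bishop-Phelps-Bollobás property of `Z` for the `θ`-numerical radius. -/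
theorem exists_attaining_near [CompleteSpace X] [UniformConvexSpace X] [CompleteSpace Z]
    (hY : IsUniformlySmooth Y) [Nontrivial W] (hθ : UniformContinuous θ)
    (h₁ : ∀ x f, θ (-x, f) = -θ (x, f)) (h₂ : ∀ x f, θ (x, -f) = -θ (x, f))
    (hne : (thetaPi θ).Nonempty) (J : Z →ₗ[ℝ] evenBCF θ W) (hJ_norm : ∀ Φ : Z, ‖J Φ‖ ≤ ‖Φ‖)
    (hJ : ∀ T : X →L[ℝ] Y, FiniteDimensional ℝ (LinearMap.range T.toLinearMap) →
      ∀ w : W, ∃ Φ : Z, (∀ p : thetaPi θ, (J Φ).1 p = thetaPiFnl p (T (thetaPiVec p)) • w) ∧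
        ‖Φ‖ ≤ ‖T‖ * ‖w‖) {ε : ℝ} (hε : 0 < ε) :
    ∃ η : ℝ, 0 < η ∧ ∀ (Φ : Z) (p : thetaPi θ), thetaRadius (J Φ) = 1 → 1 - η < ‖(J Φ).1 p‖ →
      ∃ (Ψ : Z) (q : thetaPi θ), thetaRadius (J Ψ) = 1 ∧ ‖(J Ψ).1 q‖ = 1 ∧
        ‖thetaPiVec q - thetaPiVec p‖ + ‖thetaPiFnl q - thetaPiFnl p‖ < ε ∧
        thetaRadius (J Ψ - J Φ) < ε := by
  simp only [thetaRadius_eq_norm]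
  obtain ⟨δ, hδ, hδ1, hpeak⟩ := exists_peaking_perturbation hY hθ h₁ h₂ J hJ hε
  -- Moving to `Φ'` and normalising cost `2 s` each, in total at most `ε / 2`; `s ≤ 1/8` keeps `‖J
  -- Φ'‖` positive.
  obtain ⟨s, hs, hsε, hs1⟩ : ∃ s : ℝ, 0 < s ∧ s ≤ ε / 8 ∧ s ≤ 1 / 8 :=
    ⟨min (ε / 8) (1 / 8), by positivity, min_le_left _ _, min_le_right _ _⟩
  refine ⟨s * (δ / 4), by positivity, fun Φ p hΦ hp => ?_⟩
  obtain ⟨H, hH1, hH⟩ := hpeak (J Φ) p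
  obtain ⟨hat, hfar⟩ := hH s hs.le
  -- The radius `s δ / 16` is small against the gap `s δ / 2` between `p` and the far points.
  obtain ⟨Φ', hΦ'b, hΦ'⟩ := Metric.dense_iff.1 (isSigmaPorousSet_compl_stronglyAttains hY hθ h₁ h₂
    hne J hJ_norm hJ 0).dense_compl (Φ + s • H) (s * (δ / 16)) (by positivity)
  rw [compl_compl, Set.mem_ofPred_eq, zero_add] at hΦ'
  obtain ⟨q, hq, -⟩ := hΦ'
  rw [thetaRadius_eq_norm] at hq
  rw [Metric.mem_ball, dist_eq_norm] at hΦ'b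
  have hclose : ∀ p : thetaPi θ, |‖(J Φ').1 p‖ - ‖(J Φ + s • J H).1 p‖| ≤ s * (δ / 16) := by
    intro p
    refine (abs_norm_sub_norm_le _ _).trans
      (le_trans (le_of_eq ?_) ((norm_map_apply_sub_le J hJ_norm Φ' (Φ + s • H) p).trans hΦ'b.le))
    rw [map_add, map_smul]
  have hsδ : 0 < s * δ := by positivity
  have hsδ' : s * δ ≤ s := mul_le_of_le_one_right hs.le hδ1
  have hqp : thetaPiSignDist q p < ε := by
    by_contra! hcon
    have h1 := hfar q hcon
    have h2 := abs_le.1 (hclose q)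
    have h3 := abs_le.1 (hclose p)
    have h4 := evenBCF_norm_apply_le (J Φ') p
    linarith [h2.1, h2.2, h3.1, h3.2]
  have hdist : ‖J Φ' - J Φ‖ ≤ 2 * s := by
    rw [← map_sub]
    refine (hJ_norm _).trans ?_
    have h1 : ‖Φ' - Φ‖ ≤ ‖Φ' - (Φ + s • H)‖ + ‖s • H‖ := by
      refine le_trans (le_of_eq ?_) (norm_add_le _ _)
      congr 1; abel
    have h2 : ‖s • H‖ ≤ s := by
      rw [norm_smul, Real.norm_of_nonneg hs.le]
      exact mul_le_of_le_one_right hs.le hH1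
    linarith
  have hn := abs_le.1 ((abs_norm_sub_norm_le (J Φ') (J Φ)).trans hdist)
  rw [hΦ] at hn
  have hpos : 0 < ‖J Φ'‖ := by linarith [hn.1]
  obtain ⟨q', hq', hq'p⟩ : ∃ q' : thetaPi θ, ‖(J Φ').1 q'‖ = ‖J Φ'‖ ∧
      ‖thetaPiVec q' - thetaPiVec p‖ + ‖thetaPiFnl q' - thetaPiFnl p‖ < ε := by
    rcases min_lt_iff.1 hqp with h | h
    · exact ⟨q, hq, h⟩
    · obtain ⟨q', hv, hf⟩ := exists_neg_thetaPi h₁ h₂ q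
      refine ⟨q', by rw [(J Φ').2 q q' hv hf, hq], ?_⟩
      rwa [hv, hf, ← neg_add', norm_neg, ← neg_add', norm_neg]
  refine ⟨‖J Φ'‖⁻¹ • Φ', q', ?_, ?_, hq'p, ?_⟩
  · rw [map_smul, norm_smul, norm_inv, norm_norm, inv_mul_cancel₀ hpos.ne']
  · rw [map_smul]
    change ‖‖J Φ'‖⁻¹ • (J Φ').1 q'‖ = 1
    rw [norm_smul, norm_inv, norm_norm, hq', inv_mul_cancel₀ hpos.ne']
  · have h1 : J (‖J Φ'‖⁻¹ • Φ') - J Φ = (‖J Φ'‖⁻¹ - 1) • J Φ' + (J Φ' - J Φ) := by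
      rw [map_smul]; module
    have h2 : ‖(‖J Φ'‖⁻¹ - 1) • J Φ'‖ = |1 - ‖J Φ'‖| := by
      rw [norm_smul, Real.norm_eq_abs, ← abs_of_pos hpos, ← abs_mul, abs_of_pos hpos, sub_mul,
        inv_mul_cancel₀ hpos.ne', one_mul]
    have h3 : |1 - ‖J Φ'‖| ≤ 2 * s := abs_le.2 ⟨by linarith [hn.2], by linarith [hn.1]⟩
    rw [h1]
    refine (norm_add_le _ _).trans_lt ?_
    rw [h2]
    linarith

end ThetaRadius

/-! ### The classical numerical radius -/

section NumericalRadius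

variable {X : Type*} [NormedAddCommGroup X] [NormedSpace ℝ X]

/-- The duality pairing on the product of the unit spheres of `X` and its dual. -/
def sphereEval (X : Type*) [NormedAddCommGroup X] [NormedSpace ℝ X] (p : SphereProd X X) : ℝ :=
  (p.2 : StrongDual ℝ X) (p.1 : X)

theorem uniformContinuous_sphereEval : UniformContinuous (sphereEval X) := by
  refine (LipschitzWith.of_dist_le_mul (K := 2) fun p q => ?_).uniformContinuous
  have hp : ‖(p.2 : StrongDual ℝ X)‖ = 1 := by simp
  have hq : ‖(q.1 : X)‖ = 1 := by simp
  have h1 := (p.2 : StrongDual ℝ X).le_opNorm (p.1 - q.1 : X)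
  have h2 := ((p.2 : StrongDual ℝ X) - q.2).le_opNorm (q.1 : X)
  have h3 : dist (p.1 : X) q.1 ≤ dist p q := le_max_left _ _
  have h4 : dist (p.2 : StrongDual ℝ X) q.2 ≤ dist p q := le_max_right _ _
  rw [hp, one_mul] at h1
  rw [hq, mul_one] at h2
  rw [dist_eq_norm] at h3 h4
  have e : sphereEval X p - sphereEval X q = (p.2 : StrongDual ℝ X) (p.1 - q.1 : X) +
      ((p.2 : StrongDual ℝ X) - q.2) (q.1 : X) := by
    simp [sphereEval]
  rw [dist_eq_norm, e, NNReal.coe_ofNat]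
  refine (norm_add_le _ _).trans ?_
  linarith

/-- The even function `(x, x*) ↦ x* (T x)` associated with a bounded operator `T`. -/
noncomputable def operatorForm (X : Type*) [NormedAddCommGroup X] [NormedSpace ℝ X] :
    (X →L[ℝ] X) →ₗ[ℝ] evenBCF (sphereEval X) ℝ where
  toFun T := ⟨BoundedContinuousFunction.ofNormedAddCommGroup
      (fun p => thetaPiFnl p (T (thetaPiVec p)))
      (by unfold thetaPiFnl thetaPiVec; fun_prop) ‖T‖
      (fun p => by
        refine ((thetaPiFnl p).le_opNorm _).trans ?_
        rw [norm_thetaPiFnl, one_mul]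
        simpa [norm_thetaPiVec] using T.le_opNorm (thetaPiVec p)),
    fun p q hv hf => by simp [hv, hf]⟩
  map_add' S T := by ext p; simp
  map_smul' c T := by ext p; simp

theorem operatorForm_apply (T : X →L[ℝ] X) (p : thetaPi (sphereEval X)) :
    (operatorForm X T).1 p = thetaPiFnl p (T (thetaPiVec p)) := rfl

theorem norm_operatorForm_le (T : X →L[ℝ] X) : ‖operatorForm X T‖ ≤ ‖T‖ := by
  refine (BoundedContinuousFunction.norm_le (norm_nonneg T)).2 fun p => ?_
  refine ((thetaPiFnl p).le_opNorm _).trans ?_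
  rw [norm_thetaPiFnl, one_mul]
  simpa [norm_thetaPiVec] using T.le_opNorm (thetaPiVec p)

theorem thetaRadius_operatorForm (T : X →L[ℝ] X) :
    thetaRadius (operatorForm X T) = numericalRadius T := by
  unfold thetaRadius numericalRadius
  rw [iSup]
  congr 1
  ext s
  constructor
  · rintro ⟨p, rfl⟩
    exact ⟨thetaPiVec p, thetaPiFnl p, norm_thetaPiVec p, norm_thetaPiFnl p, p.2, rfl⟩
  · rintro ⟨x, f, hx, hf, hfx, rfl⟩
    exact ⟨⟨(⟨x, by simpa using hx⟩, ⟨f, by simpa using hf⟩), hfx⟩, rfl⟩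

theorem isSigmaPorousSet_compl_attainsNumericalRadius [Nontrivial X] [CompleteSpace X]
    [UniformConvexSpace X] (hX : IsUniformlySmooth X) :
    IsSigmaPorousSet {T : X →L[ℝ] X | AttainsNumericalRadius T}ᶜ := by
  have hne : (thetaPi (sphereEval X)).Nonempty := by
    obtain ⟨x, hx⟩ := exists_norm_eq X zero_le_one
    obtain ⟨f, hf, hfx⟩ := exists_dual_vector ℝ x (by rw [hx]; exact one_ne_zero)
    refine ⟨(⟨x, by simpa using hx⟩, ⟨f, by simpa using hf⟩), ?_⟩
    change f x = 1
    rw [hfx, hx]; rfl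
  refine (isSigmaPorousSet_compl_stronglyAttains hX uniformContinuous_sphereEval
    (fun x f => by simp [sphereEval]) (fun x f => by simp [sphereEval]) hne (operatorForm X)
    norm_operatorForm_le (fun T _ w => ⟨w • T, fun p => ?_, ?_⟩) 0).mono
    (Set.compl_subset_compl.2 ?_)
  · simp [operatorForm_apply, mul_comm]
  · rw [norm_smul, mul_comm]
  · rintro T hT
    rw [Set.mem_ofPred_eq, zero_add] at hT
    obtain ⟨p, hp, -⟩ := hT
    rw [thetaRadius_operatorForm] at hp
    exact ⟨thetaPiVec p, thetaPiFnl p, norm_thetaPiVec p, norm_thetaPiFnl p, p.2, hp⟩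

end NumericalRadius

theorem corollary1p1
    {X Y W Z : Type*}
    [NormedAddCommGroup X] [NormedSpace ℝ X] [CompleteSpace X] [UniformConvexSpace X]
    [NormedAddCommGroup Y] [NormedSpace ℝ Y] [CompleteSpace Y] (hY : IsUniformlySmooth Y)
    [NormedAddCommGroup W] [NormedSpace ℝ W] [CompleteSpace W] [Nontrivial W]
    (θ : SphereProd X Y → ℝ)
    (hθ_unif : UniformContinuous θ)
    (hθ_odd₁ : ∀ x f, θ (-x, f) = -θ (x, f))
    (hθ_odd₂ : ∀ x f, θ (x, -f) = -θ (x, f))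
    (hθ_ne : (thetaPi θ).Nonempty)
    -- `Z` carries its own norm; `J` is the inclusion when `Z` is a subspace of `C_{b,e}`
    [NormedAddCommGroup Z] [NormedSpace ℝ Z] [CompleteSpace Z]
    (J : Z →ₗ[ℝ] evenBCF θ W)
    (hJ_norm : ∀ Φ : Z, ‖J Φ‖ ≤ ‖Φ‖)
    (hJ_finiteRank : ∀ T : X →L[ℝ] Y, FiniteDimensional ℝ (LinearMap.range T.toLinearMap) →
      ∀ w : W, ∃ Φ : Z, (∀ p : thetaPi θ, (J Φ).1 p = thetaPiFnl p (T (thetaPiVec p)) • w) ∧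
        ‖Φ‖ ≤ ‖T‖ * ‖w‖) :
    (∀ Θ : evenBCF θ W,
      IsSigmaPorousSet {Φ : Z | StronglyAttainsThetaRadius (Θ + J Φ)}ᶜ) ∧
    (∀ ε : ℝ, 0 < ε → ∃ η : ℝ, 0 < η ∧
      ∀ (Φ : Z) (p : thetaPi θ), thetaRadius (J Φ) = 1 → 1 - η < ‖(J Φ).1 p‖ →
        ∃ (Ψ : Z) (q : thetaPi θ), thetaRadius (J Ψ) = 1 ∧ ‖(J Ψ).1 q‖ = 1 ∧
          ‖thetaPiVec q - thetaPiVec p‖ + ‖thetaPiFnl q - thetaPiFnl p‖ < ε ∧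
          thetaRadius (J Ψ - J Φ) < ε) ∧
    (IsUniformlySmooth X →
      IsSigmaPorousSet {T : X →L[ℝ] X | AttainsNumericalRadius T}ᶜ) := by
  -- For `X = 0` the set of norming pairs in (3) would be empty; a point of `Π_θ` excludes this.
  have hX : Nontrivial X := by
    obtain ⟨p⟩ := hθ_ne.to_subtype
    exact ⟨thetaPiVec p, 0, norm_ne_zero_iff.1 (by rw [norm_thetaPiVec]; exact one_ne_zero)⟩
  exact ⟨isSigmaPorousSet_compl_stronglyAttains hY hθ_unif hθ_odd₁ hθ_odd₂ hθ_ne J hJ_norm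
      hJ_finiteRank,
    fun ε hε => exists_attaining_near hY hθ_unif hθ_odd₁ hθ_odd₂ hθ_ne J hJ_norm hJ_finiteRank hε,
    isSigmaPorousSet_compl_attainsNumericalRadius⟩
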